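/- Let $n \ge 1$, let $|\cdot|$ be the Euclidean norm on $\mathbf{R}^n$, and let $\phi : \mathbf{R}^n \to \mathbf{R}$ be a norm which is of class $\mathcal{C}^2$ on $\mathbf{R}^n \setminus \{0\}$ and uniformly convex, in the sense that for some $\gamma > 0$ the function $x \mapsto \phi(x) - \gamma |x|$ is convex on $\mathbf{R}^n$. Let $K \subseteq \mathbf{R}^n$ be a closed set and define \[ \delta_K^\phi(x) = \inf\{\phi(y-x) : y \in K\} \quad (x \in \mathbf{R}^n), \] \[ N^\phi(K) = \{(a,\eta) : a \in K,\ \eta \in \mathbf{R}^n,\ \phi(\eta) = 1,\ \delta_K^\phi(a+s\eta) = s \text{ for some } s > 0\}, \] \[ r_K^\phi(a,\eta) = \sup\{s > 0 : \delta_K^\phi(a+s\eta) = s\} \in (0,+\infty] \quad \text{for } (a,\eta) \in N^\phi(K). \] Let $1 < \sigma < \infty$ and $0 < s < t < \infty$, and let \[ K_{\sigma,s,t} = \{a + \rho\eta : (a,\eta) \in N^\phi(K),\ s \le \rho \le t,\ \sigma\rho \le r_K^\phi(a,\eta)\}. \] Then $\delta_K^\phi$ is differentiable at every point of $K_{\sigma,s,t}$,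 and the restriction of its gradient $\nabla\delta_K^\phi$ to $K_{\sigma,s,t}$ is Lipschitz continuous, i.e. there is $L < \infty$ such that $|\nabla\delta_K^\phi(x) - \nabla\delta_K^\phi(y)| \le L\,|x-y|$ for all $x, y \in K_{\sigma,s,t}$. -/

import Mathlib

/-- `φ` is a uniformly convex norm on `ℝⁿ`: it is a norm (a seminorm vanishing only at the origin)
and `x ↦ φ x - γ |x|` is convex for some `γ > 0`, where `|x|` is the Euclidean norm. -/
structure IsUniformlyConvexNorm {n : ℕ} (φ : Seminorm ℝ (EuclideanSpace ℝ (Fin n))) : Prop where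
  eq_zero_of_apply_eq_zero : ∀ x : EuclideanSpace ℝ (Fin n), φ x = 0 → x = 0
  exists_convexOn_sub : ∃ γ : ℝ, 0 < γ ∧
    ConvexOn ℝ Set.univ (fun x : EuclideanSpace ℝ (Fin n) => φ x - γ * ‖x‖)

/-- The `φ`-distance function `x ↦ inf {φ (y - x) : y ∈ K}`. -/
noncomputable def phiDist {n : ℕ} (φ : Seminorm ℝ (EuclideanSpace ℝ (Fin n)))
    (K : Set (EuclideanSpace ℝ (Fin n))) (x : EuclideanSpace ℝ (Fin n)) : ℝ :=
  sInf ((fun y => φ (y - x)) '' K)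

/-- The unit `φ`-normal bundle of `K`: the pairs `(a, η)` with `a ∈ K`, `φ η = 1`, and
`phiDist φ K (a + s η) = s` for some `s > 0`. -/
def unitNormalBundle {n : ℕ} (φ : Seminorm ℝ (EuclideanSpace ℝ (Fin n)))
    (K : Set (EuclideanSpace ℝ (Fin n))) :
    Set (EuclideanSpace ℝ (Fin n) × EuclideanSpace ℝ (Fin n)) :=
  {p | p.1 ∈ K ∧ φ p.2 = 1 ∧ ∃ s : ℝ, 0 < s ∧ phiDist φ K (p.1 + s • p.2) = s}

/-- The `φ`-reach `sup {s > 0 : phiDist φ K (a + s η) = s}`, with values in `(0, ∞]` on the unit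
`φ`-normal bundle; the supremum is taken in the extended reals. -/
noncomputable def phiReach {n : ℕ} (φ : Seminorm ℝ (EuclideanSpace ℝ (Fin n)))
    (K : Set (EuclideanSpace ℝ (Fin n))) (a η : EuclideanSpace ℝ (Fin n)) : EReal :=
  sSup ((fun s : ℝ => (s : EReal)) '' {s : ℝ | 0 < s ∧ phiDist φ K (a + s • η) = s})

/-- The set of points `a + ρ η` with `(a, η)` in the unit `φ`-normal bundle of `K`, `s ≤ ρ ≤ t`
and `σ ρ ≤ phiReach φ K a η`. -/
def awayFromCut {n : ℕ} (φ : Seminorm ℝ (EuclideanSpace ℝ (Fin n)))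
    (K : Set (EuclideanSpace ℝ (Fin n))) (σ s t : ℝ) : Set (EuclideanSpace ℝ (Fin n)) :=
  {x | ∃ (a η : EuclideanSpace ℝ (Fin n)) (ρ : ℝ), (a, η) ∈ unitNormalBundle φ K ∧
    s ≤ ρ ∧ ρ ≤ t ∧ ((σ * ρ : ℝ) : EReal) ≤ phiReach φ K a η ∧ x = a + ρ • η}

/-! At `x = a + ρη`, with the ray minimizing up to time `ρ + τ`, the distance function is touched
from above by `y ↦ φ (y - a)` and from below by `y ↦ ρ + τ - φ (a + (ρ + τ)η - y)`. A quadratic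
upper bound for `φ` along rays (`Seminorm.exists_smul_add_le`) controls both sides with the same
linear part, since it depends on `η` alone. As `ρ` and `τ` are bounded below, the remainder is
uniform, and uniform two-sided quadratic expansions force the linear parts to vary in a Lipschitz
way (`norm_sub_le_of_abs_sub_le_sq`). -/

section QuadraticApproximation

variable {E : Type*} [NormedAddCommGroup E] [NormedSpace ℝ E]

/-- A global second order expansion with remainder `C ‖h‖ ^ 2` identifies the derivative. -/
theorem hasFDerivAt_of_abs_sub_le_sq {f : E → ℝ} {x : E} {D : E →L[ℝ] ℝ} {C : ℝ}
    (h : ∀ v, |f (x + v) - f x - D v| ≤ C * ‖v‖ ^ 2) : HasFDerivAt f D x := by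
  rw [hasFDerivAt_iff_isLittleO_nhds_zero]
  have h1 : (fun v : E => f (x + v) - f x - D v) =O[nhds 0] fun v => ‖v‖ ^ 2 :=
    Asymptotics.IsBigO.of_bound C (Filter.Eventually.of_forall fun v => by
      simpa using h v)
  have h2 : (fun v : E => ‖v‖ ^ 2) =o[nhds 0] fun v => v := by
    simpa using Asymptotics.isLittleO_norm_pow_id (E' := E) one_lt_two
  exact h1.trans_isLittleO h2

/-- If `f` has a second order expansion with uniform remainder at `p` and at `q`, then the
linear parts differ by at most `6 C ‖p - q‖`. -/
theorem norm_sub_le_of_abs_sub_le_sq {f : E → ℝ} {p q : E} {P Q : E →L[ℝ] ℝ} {C : ℝ}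
    (hC : 0 ≤ C)
    (hp : ∀ v, |f (p + v) - f p - P v| ≤ C * ‖v‖ ^ 2)
    (hq : ∀ v, |f (q + v) - f q - Q v| ≤ C * ‖v‖ ^ 2) :
    ‖P - Q‖ ≤ 6 * C * ‖p - q‖ := by
  rcases eq_or_ne p q with rfl | hne
  · have := (hasFDerivAt_of_abs_sub_le_sq hp).unique (hasFDerivAt_of_abs_sub_le_sq hq)
    simp [this]
  have hd : 0 < ‖p - q‖ := norm_pos_iff.2 (sub_ne_zero.2 hne)
  -- Expand `f (q + w)` from `q` and from `p`, and `f q` from `p`: the values cancel, leaving `(P -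
  -- Q) w` and remainders `1 + 4 + 1 = 6` times `C ‖p - q‖ ^ 2`.
  have key : ∀ w : E, ‖w‖ = ‖p - q‖ → |(P - Q) w| ≤ 6 * C * ‖p - q‖ ^ 2 := by
    intro w hw
    have e1 := hq w
    have e2 := hp (w + (q - p))
    have e3 := hp (q - p)
    have h1 : ‖w + (q - p)‖ ≤ 2 * ‖p - q‖ := by
      have := norm_add_le w (q - p)
      rw [norm_sub_rev q p] at this
      linarith
    have h2 : C * ‖w + (q - p)‖ ^ 2 ≤ C * (2 * ‖p - q‖) ^ 2 := by gcongr
    rw [show p + (w + (q - p)) = q + w by abel, map_add] at e2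
    rw [add_sub_cancel, norm_sub_rev q p] at e3
    rw [hw] at e1
    rw [abs_le] at e1 e2 e3 ⊢
    rw [sub_apply]
    constructor <;> nlinarith [e1.1, e1.2, e2.1, e2.2, e3.1, e3.2]
  refine ContinuousLinearMap.opNorm_le_bound _ (by positivity) fun v => ?_
  rcases eq_or_ne v 0 with rfl | hv
  · simp
  have hv' : 0 < ‖v‖ := norm_pos_iff.2 hv
  have := key ((‖p - q‖ / ‖v‖) • v) (by
    rw [norm_smul, Real.norm_of_nonneg (by positivity)]; field_simp)
  rw [map_smul, smul_eq_mul, abs_mul, abs_of_pos (by positivity : 0 < ‖p - q‖ / ‖v‖)] at this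
  rw [Real.norm_eq_abs]
  rw [div_mul_eq_mul_div, div_le_iff₀ hv'] at this
  nlinarith

end QuadraticApproximation

section SeminormExpansion

variable {E : Type*} [NormedAddCommGroup E] [NormedSpace ℝ E] [FiniteDimensional ℝ E]

/-- A seminorm on a finite-dimensional space is bounded by a multiple of the norm. -/
theorem Seminorm.exists_pos_le_mul_norm (φ : Seminorm ℝ E) :
    ∃ B : ℝ, 0 < B ∧ ∀ x, φ x ≤ B * ‖x‖ :=
  Seminorm.bound_of_continuous_normedSpace φ
    (continuousOn_univ.1 (φ.convexOn.continuousOn isOpen_univ))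

/-- Second order upper bound, uniform over the unit sphere, for a seminorm which is `C²` away from
the origin. -/
theorem Seminorm.exists_le_add_fderiv_add_sq_of_norm_eq_one (φ : Seminorm ℝ E)
    (hφ : ContDiffOn ℝ 2 φ {0}ᶜ) :
    ∃ C : ℝ, 0 < C ∧ ∀ u : E, ‖u‖ = 1 → ∀ h,
      φ (u + h) ≤ φ u + fderiv ℝ φ u h + C * ‖h‖ ^ 2 := by
  obtain ⟨B, hB, hφB⟩ := φ.exists_pos_le_mul_norm
  have hopen : IsOpen ({0}ᶜ : Set E) := isOpen_compl_singleton
  have hd1 : ContDiffOn ℝ 1 (fderiv ℝ φ) {0}ᶜ := hφ.fderiv_of_isOpen hopen (by norm_num)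
  have hd2 : ContinuousOn (fderiv ℝ (fderiv ℝ φ)) {0}ᶜ :=
    hd1.continuousOn_fderiv_of_isOpen hopen (by norm_num)
  have hA : IsCompact (Metric.closedBall (0 : E) 2 ∩ {x | 1 / 2 ≤ ‖x‖}) :=
    (isCompact_closedBall _ _).inter_right (isClosed_le continuous_const continuous_norm)
  have hA0 : Metric.closedBall (0 : E) 2 ∩ {x | 1 / 2 ≤ ‖x‖} ⊆ {0}ᶜ := by
    rintro x ⟨-, hx⟩ rfl
    norm_num at hx
  obtain ⟨M, hM⟩ := hA.exists_bound_of_continuousOn (f := fderiv ℝ (fderiv ℝ φ)) (hd2.mono hA0)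
  refine ⟨max M 0 + 4 * B, by positivity, fun u hu h => ?_⟩
  have hball : Metric.closedBall u (1 / 2) ⊆ Metric.closedBall (0 : E) 2 ∩ {x | 1 / 2 ≤ ‖x‖} := by
    intro x hx
    rw [mem_closedBall_iff_norm] at hx
    have h1 := norm_sub_norm_le x u
    have h2 := norm_sub_norm_le u x
    rw [norm_sub_rev] at h2
    refine ⟨?_, ?_⟩
    · rw [mem_closedBall_zero_iff]; linarith
    · show (1 / 2 : ℝ) ≤ ‖x‖
      linarith
  have hdiff : ∀ x ∈ Metric.closedBall u (1 / 2), DifferentiableAt ℝ φ x := fun x hx =>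
    (hφ.differentiableOn (by norm_num)).differentiableAt (hopen.mem_nhds (hA0 (hball hx)))
  have hdiff' : ∀ x ∈ Metric.closedBall u (1 / 2), DifferentiableAt ℝ (fderiv ℝ φ) x :=
    fun x hx =>
      (hd1.differentiableOn (by norm_num)).differentiableAt (hopen.mem_nhds (hA0 (hball hx)))
  have hu0 : u ∈ Metric.closedBall u (1 / 2) := Metric.mem_closedBall_self (by norm_num)
  -- For small `h` the ball avoids the origin and the Hessian bound applies; for large `h` the
  -- linear growth `2 B ‖h‖` is at most `4 B ‖h‖ ^ 2`.
  rcases le_or_gt ‖h‖ (1 / 2) with hh | hh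
  · have hsub : Metric.closedBall u ‖h‖ ⊆ Metric.closedBall u (1 / 2) :=
      Metric.closedBall_subset_closedBall hh
    have hlip : ∀ x ∈ Metric.closedBall u ‖h‖,
        ‖fderiv ℝ φ x - fderiv ℝ φ u‖ ≤ max M 0 * ‖h‖ := by
      intro x hx
      refine ((_root_.convex_closedBall u (1 / 2)).norm_image_sub_le_of_norm_fderiv_le hdiff'
        (fun y hy => (hM y (hball hy)).trans (le_max_left _ 0)) hu0 (hsub hx)).trans ?_
      rw [mem_closedBall_iff_norm] at hx
      gcongr
    have := (_root_.convex_closedBall u ‖h‖).norm_image_sub_le_of_norm_fderiv_le'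
      (fun x hx => hdiff x (hsub hx)) hlip (Metric.mem_closedBall_self (norm_nonneg h))
      (show u + h ∈ Metric.closedBall u ‖h‖ by simp)
    rw [add_sub_cancel_left, Real.norm_eq_abs] at this
    nlinarith [le_abs_self (φ (u + h) - φ u - fderiv ℝ φ u h), mul_nonneg hB.le (sq_nonneg ‖h‖)]
  · have h1 : φ (u + h) ≤ φ u + B * ‖h‖ := (map_add_le_add φ u h).trans (by gcongr; exact hφB h)
    have hL : LipschitzWith ⟨B, hB.le⟩ φ := LipschitzWith.of_dist_le_mul fun x y => by
      rw [dist_eq_norm, dist_eq_norm]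
      exact (abs_sub_map_le_sub φ x y).trans (hφB _)
    have h2 : ‖fderiv ℝ φ u h‖ ≤ B * ‖h‖ :=
      (fderiv ℝ φ u).le_of_opNorm_le (norm_fderiv_le_of_lipschitz ℝ hL) h
    rw [Real.norm_eq_abs, abs_le] at h2
    have h3 : 0 ≤ max M 0 * ‖h‖ ^ 2 := by positivity
    have h4 : 2 * (B * ‖h‖) ≤ 4 * B * ‖h‖ ^ 2 := by
      nlinarith [mul_nonneg (mul_nonneg hB.le (norm_nonneg h)) (sub_nonneg.2 hh.le)]
    linarith [h2.1]

/-- Second order upper bound along rays, for a seminorm which is `C²` away from the origin: the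
linear part depends on the direction only and the remainder is inversely proportional to the
distance from the origin. -/
theorem Seminorm.exists_smul_add_le (φ : Seminorm ℝ E) (hφ : ContDiffOn ℝ 2 φ {0}ᶜ) :
    ∃ C : ℝ, 0 < C ∧ ∀ η : E, φ η = 1 → ∃ D : E →L[ℝ] ℝ, ∀ c : ℝ, 0 < c → ∀ h,
      φ (c • η + h) ≤ c + D h + C / c * ‖h‖ ^ 2 := by
  obtain ⟨B, hB, hφB⟩ := φ.exists_pos_le_mul_norm
  obtain ⟨C, hC, hφC⟩ := φ.exists_le_add_fderiv_add_sq_of_norm_eq_one hφ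
  refine ⟨C * B, by positivity, fun η hη => ?_⟩
  have hη0 : 0 < ‖η‖ := by
    refine norm_pos_iff.2 ?_
    rintro rfl
    simp at hη
  refine ⟨fderiv ℝ φ (‖η‖⁻¹ • η), fun c hc h => ?_⟩
  have key := hφC (‖η‖⁻¹ • η) (by rw [norm_smul, norm_inv, norm_norm]; field_simp)
    ((c * ‖η‖)⁻¹ • h)
  have hr : 0 < c * ‖η‖ := by positivity
  have e1 : φ (c • η + h) = (c * ‖η‖) * φ (‖η‖⁻¹ • η + (c * ‖η‖)⁻¹ • h) := by
    have : c • η + h = (c * ‖η‖) • (‖η‖⁻¹ • η + (c * ‖η‖)⁻¹ • h) := by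
      rw [smul_add, smul_smul, smul_smul, mul_inv_cancel₀ hr.ne', one_smul, mul_assoc,
        mul_inv_cancel₀ hη0.ne', mul_one]
    rw [this, map_smul_eq_mul, Real.norm_of_nonneg hr.le]
  have e2 : (c * ‖η‖) * φ (‖η‖⁻¹ • η) = c := by
    rw [map_smul_eq_mul, norm_inv, norm_norm, hη]
    field_simp
  have h2 := mul_le_mul_of_nonneg_left key hr.le
  rw [← e1, mul_add, mul_add, e2, map_smul, smul_eq_mul, mul_inv_cancel_left₀ hr.ne', norm_smul,
    norm_inv, Real.norm_of_nonneg hr.le] at h2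
  have h3 : c * ‖η‖ * (C * ((c * ‖η‖)⁻¹ * ‖h‖) ^ 2) = C / (c * ‖η‖) * ‖h‖ ^ 2 := by
    field_simp
  rw [h3] at h2
  -- This uses `1 = φ η ≤ B ‖η‖`.
  have h4 : C / (c * ‖η‖) ≤ C * B / c := by
    rw [div_le_div_iff₀ hr hc]
    have := hφB η
    rw [hη] at this
    nlinarith [mul_le_mul_of_nonneg_left this (mul_pos hC hc).le]
  have h5 := mul_le_mul_of_nonneg_right h4 (sq_nonneg ‖h‖)
  linarith

end SeminormExpansion

section PhiDist

variable {n : ℕ} (φ : Seminorm ℝ (EuclideanSpace ℝ (Fin n))) {K : Set (EuclideanSpace ℝ (Fin n))}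

theorem phiDist_le {a : EuclideanSpace ℝ (Fin n)} (ha : a ∈ K) (x : EuclideanSpace ℝ (Fin n)) :
    phiDist φ K x ≤ φ (a - x) :=
  csInf_le ⟨0, by rintro _ ⟨y, -, rfl⟩; exact apply_nonneg φ _⟩ ⟨a, ha, rfl⟩

theorem phiDist_le_add (hK : K.Nonempty) (x y : EuclideanSpace ℝ (Fin n)) :
    phiDist φ K y ≤ phiDist φ K x + φ (y - x) := by
  rw [← sub_le_iff_le_add]
  refine le_csInf (hK.image _) ?_
  rintro _ ⟨k, hk, rfl⟩
  have h1 := phiDist_le φ hk y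
  have h2 := map_sub_le_add φ (k - x) (y - x)
  rw [sub_sub_sub_cancel_right] at h2
  linarith

/-- If the ray from `a ∈ K` in the direction `η` is minimizing up to time `ρ + τ`, then the distance
function is squeezed at time `ρ` between two functions with matching second order expansions. -/
theorem abs_phiDist_sub_le {a η : EuclideanSpace ℝ (Fin n)} (ha : a ∈ K) (hη : φ η = 1)
    {D : EuclideanSpace ℝ (Fin n) →L[ℝ] ℝ} {C : ℝ}
    (hD : ∀ c : ℝ, 0 < c → ∀ h, φ (c • η + h) ≤ c + D h + C / c * ‖h‖ ^ 2)
    {ρ τ M : ℝ} (hρ : 0 < ρ) (hτ : 0 < τ) (hMρ : C / ρ ≤ M) (hMτ : C / τ ≤ M)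
    (hmin : phiDist φ K (a + (ρ + τ) • η) = ρ + τ) (h : EuclideanSpace ℝ (Fin n)) :
    |phiDist φ K (a + ρ • η + h) - phiDist φ K (a + ρ • η) - D h| ≤ M * ‖h‖ ^ 2 := by
  have upper : ∀ v, phiDist φ K (a + ρ • η + v) ≤ φ (ρ • η + v) := fun v => by
    have := phiDist_le φ ha (a + ρ • η + v)
    rwa [map_sub_rev, show a + ρ • η + v - a = ρ • η + v by abel] at this
  have lower : ∀ v, ρ + τ ≤ phiDist φ K (a + ρ • η + v) + φ (τ • η + -v) := fun v => by
    have := phiDist_le_add φ ⟨a, ha⟩ (a + ρ • η + v) (a + (ρ + τ) • η)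
    rwa [hmin, show a + (ρ + τ) • η - (a + ρ • η + v) = τ • η + -v by module] at this
  -- At `v = 0` the two bounds pin the distance at time `ρ` to exactly `ρ`.
  have u0 := upper 0
  have l0 := lower 0
  rw [add_zero, add_zero, map_smul_eq_mul, hη, Real.norm_of_nonneg hρ.le] at u0
  rw [add_zero, neg_zero, add_zero, map_smul_eq_mul, hη, Real.norm_of_nonneg hτ.le] at l0
  have u1 := hD ρ hρ h
  have l1 := hD τ hτ (-h)
  rw [map_neg, norm_neg] at l1
  have b1 := mul_le_mul_of_nonneg_right hMρ (sq_nonneg ‖h‖)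
  have b2 := mul_le_mul_of_nonneg_right hMτ (sq_nonneg ‖h‖)
  rw [abs_le]
  constructor <;> linarith [upper h, lower h]

/-- The distance function has a second order expansion at the points of `awayFromCut φ K σ s t`,
with a remainder that is uniform in the point. -/
theorem exists_abs_phiDist_sub_le_on_awayFromCut (hφ : ContDiffOn ℝ 2 φ {0}ᶜ) {σ s : ℝ} (t : ℝ)
    (hσ : 1 < σ) (hs : 0 < s) :
    ∃ M : ℝ, 0 ≤ M ∧ ∀ x ∈ awayFromCut φ K σ s t, ∃ D : EuclideanSpace ℝ (Fin n) →L[ℝ] ℝ, ∀ h,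
      |phiDist φ K (x + h) - phiDist φ K x - D h| ≤ M * ‖h‖ ^ 2 := by
  obtain ⟨C, hC, hφC⟩ := φ.exists_smul_add_le hφ
  have hσ' : 0 < (σ - 1) / 2 := by linarith
  refine ⟨max (C / s) (C / ((σ - 1) / 2 * s)), by positivity, ?_⟩
  rintro x ⟨a, η, ρ, ⟨ha, hη, -⟩, hsρ, -, hreach, rfl⟩
  obtain ⟨D, hD⟩ := hφC η hη
  have hρ : 0 < ρ := hs.trans_le hsρ
  -- The supremum need not be known to be attained; halving the excess `σ - 1` makes the inequality
  -- strict, so some minimizing time `r` lies beyond.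
  have hlt : (((1 + (σ - 1) / 2) * ρ : ℝ) : EReal) < phiReach φ K a η :=
    lt_of_lt_of_le (EReal.coe_lt_coe_iff.2 (by nlinarith)) hreach
  obtain ⟨_, ⟨r, ⟨-, hr⟩, rfl⟩, hlt⟩ := lt_sSup_iff.1 hlt
  have hr' := EReal.coe_lt_coe_iff.1 hlt
  have hτ : (σ - 1) / 2 * s ≤ r - ρ := by nlinarith
  have hτ0 : 0 < (σ - 1) / 2 * s := by positivity
  refine ⟨D, abs_phiDist_sub_le φ ha hη hD hρ (hτ0.trans_le hτ) (le_max_of_le_left ?_)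
    (le_max_of_le_right ?_) ?_⟩
  · gcongr
  · gcongr
  · rw [add_sub_cancel]
    exact hr

end PhiDist

theorem theorem1p4 (n : ℕ) (φ : Seminorm ℝ (EuclideanSpace ℝ (Fin n)))
    (hφ : IsUniformlyConvexNorm φ) (hφ2 : ContDiffOn ℝ 2 φ {0}ᶜ)
    (K : Set (EuclideanSpace ℝ (Fin n))) (hK : IsClosed K)
    (σ s t : ℝ) (hσ : 1 < σ) (hs : 0 < s) (hst : s < t) :
    (∀ x ∈ awayFromCut φ K σ s t, DifferentiableAt ℝ (phiDist φ K) x) ∧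
      ∃ L : NNReal, LipschitzOnWith L (gradient (phiDist φ K)) (awayFromCut φ K σ s t) := by
  obtain ⟨M, hM, hexp⟩ := exists_abs_phiDist_sub_le_on_awayFromCut φ (K := K) hφ2 t hσ hs
  refine ⟨fun x hx => ?_, ⟨6 * M, by positivity⟩, LipschitzOnWith.of_dist_le_mul ?_⟩
  · obtain ⟨D, hD⟩ := hexp x hx
    exact (hasFDerivAt_of_abs_sub_le_sq hD).differentiableAt
  · intro x hx y hy
    obtain ⟨P, hP⟩ := hexp x hx
    obtain ⟨Q, hQ⟩ := hexp y hy
    rw [dist_eq_norm, dist_eq_norm, gradient, gradient,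
      (hasFDerivAt_of_abs_sub_le_sq hP).fderiv, (hasFDerivAt_of_abs_sub_le_sq hQ).fderiv,
      ← map_sub, LinearIsometryEquiv.norm_map]
    exact norm_sub_le_of_abs_sub_le_sq hM hP hQ
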